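/- Work in the circuit framework for generalised probabilistic theories: system types and (outcomes of) devices form a symmetric monoidal category; closed circuits are assigned non-negative probabilities, which factorise over disconnected parts and sum to $1$ over the outcomes of a closed circuit of devices; devices are closed under sequential and parallel composition; outcomes giving the same probabilities in all experiments are identified; and the real vector space generated by the states of each system is finite dimensional. Let $Q$ be a system with $N$ "slits", i.e. with transformations $P_I$, $I\subseteq\{1,\dots,N\}$, satisfying $P_IP_J=P_{I\cap J}$, and let $\omega_I=\sum_{J\subseteq I}(-1)^{|I|+|J|}P_J$ be the coherence-projectors. Assume that states can be represented as a rank-$k$ tensor: for every further system $E$, every vector $|s)$ in the space generated by the states of $QE$ satisfies $$|s)=\sum_{1\le |I|\le k}\omega_I|s),$$ where $\omega_I$ acts on $Q$ and $k\ge 1$ is a constant. Let an oracle with control $Q$ and target $T$ be given: for each $f:\{1,\dots,N\}\to\{0,1\}$, a deterministic transformation $O_f$ of $QT$ which is controlled, $O_f(P_{\{i\}}\otimes \mathrm{id}_T)=P_{\{i\}}\otimes U_{f(i)}$ for fixed transformations $U_0,U_1$ of $T$, and for which $O_f(P_I\otimes\mathrm{id}_T)=O_g(P_I\otimes\mathrm{id}_T)$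 whenever $f=g$ on $I$. An $n$-query algorithm is a closed circuit, not depending on $f$, built from devices of the theory and $n$ uses of $O_f$, followed by a classical function of the circuit outcome. Then: 1. (PARITY) If an $n$-query algorithm outputs $f(1)\oplus\cdots\oplus f(N)$ with probability greater than $1/2$ for every $f:\{1,\dots,N\}\to\{0,1\}$, then $n\ge\lceil N/k\rceil$. 2. (Search) Unstructured search on a database of size $N$ needs $\Omega(\sqrt{N/k})$ queries: for every constant $k\ge1$ and every constant success probability $p>0$ there are $\delta>0$ and $N_0$, depending only on $k$ and $p$, such that for all $N\ge N_0$ and every theory, slits and oracle as above, if an $n$-query algorithm outputs $x$ with probability at least $p$ whenever $f$ is the function marking exactly the item $x$, for every $x\in\{1,\dots,N\}$, then $n\ge\delta\sqrt{N/k}$. -/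

import Mathlib

open CategoryTheory MonoidalCategory

universe v u

/-- A generalised probabilistic theory in the circuit framework.  Objects of the symmetric monoidal
category `C` are system types, a morphism `A ⟶ B` is an (equivalence class of a) particular outcome
of a device with input type `A` and output type `B`; composition and tensor product are
sequential and parallel composition.  In particular states of `A` are morphisms `𝟙_ C ⟶ A`, effects
are morphisms `A ⟶ 𝟙_ C` and outcomes of closed circuits are morphisms `𝟙_ C ⟶ 𝟙_ C`. -/
structure ProbTheory (C : Type u) [Category.{v} C] [MonoidalCategory C] [SymmetricCategory C] where
  /-- `IsTest t`: the family `t`, indexed by the positions of the classical pointer, is a device. -/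
  IsTest : ∀ {A B : C} {X : Type} [Fintype X], (X → (A ⟶ B)) → Prop
  /-- The probability of an outcome of a closed circuit. -/
  prob : (𝟙_ C ⟶ 𝟙_ C) → ℝ
  prob_nonneg : ∀ a, 0 ≤ prob a
  prob_id : prob (𝟙 (𝟙_ C)) = 1
  /-- Probabilities factorise over disconnected closed circuits. -/
  prob_comp : ∀ a b, prob (a ≫ b) = prob a * prob b
  sum_prob : ∀ {X : Type} [Fintype X] (t : X → (𝟙_ C ⟶ 𝟙_ C)), IsTest t → ∑ x, prob (t x) = 1
  /-- Every outcome is an outcome of some device. -/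
  exists_test : ∀ {A B : C} (g : A ⟶ B),
    ∃ (X : Type) (_ : Fintype X) (t : X → (A ⟶ B)) (x : X), IsTest t ∧ t x = g
  /-- Devices are closed under sequential composition. -/
  test_comp : ∀ {A B D : C} {X Y : Type} [Fintype X] [Fintype Y]
    (s : X → (A ⟶ B)) (t : Y → (B ⟶ D)), IsTest s → IsTest t →
      IsTest (fun z : X × Y => s z.1 ≫ t z.2)
  /-- Devices are closed under parallel composition. -/
  test_tensor : ∀ {A B A' B' : C} {X Y : Type} [Fintype X] [Fintype Y]
    (s : X → (A ⟶ B)) (t : Y → (A' ⟶ B')), IsTest s → IsTest t →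
      IsTest (fun z : X × Y => s z.1 ⊗ₘ t z.2)
  /- Wires, and the regrouping and crossing of wires, are devices with one pointer position. -/
  test_id : ∀ A : C, IsTest (fun _ : Unit => 𝟙 A)
  test_braiding : ∀ A B : C, IsTest (fun _ : Unit => (β_ A B).hom)
  test_associator : ∀ A B D : C, IsTest (fun _ : Unit => (α_ A B D).hom)
  test_associator_inv : ∀ A B D : C, IsTest (fun _ : Unit => (α_ A B D).inv)
  test_leftUnitor : ∀ A : C, IsTest (fun _ : Unit => (λ_ A).hom)
  test_leftUnitor_inv : ∀ A : C, IsTest (fun _ : Unit => (λ_ A).inv)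
  test_rightUnitor : ∀ A : C, IsTest (fun _ : Unit => (ρ_ A).hom)
  test_rightUnitor_inv : ∀ A : C, IsTest (fun _ : Unit => (ρ_ A).inv)
  /-- Outcomes yielding the same probabilities in all experiments are identified. -/
  eq_of_prob : ∀ {A B : C} (g h : A ⟶ B),
    (∀ (E : C) (s : 𝟙_ C ⟶ A ⊗ E) (e : B ⊗ E ⟶ 𝟙_ C),
      prob (s ≫ g ▷ E ≫ e) = prob (s ≫ h ▷ E ≫ e)) → g = h
  /-- The vector space generated by the states of a system is finite dimensional. -/
  finite_dim : ∀ A : C, FiniteDimensional ℝ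
    (Submodule.span ℝ (Set.range fun (s : 𝟙_ C ⟶ A) (e : A ⟶ 𝟙_ C) => prob (s ≫ e)))

namespace ProbTheory

variable {C : Type u} [Category.{v} C] [MonoidalCategory C] [SymmetricCategory C]

/-- The real vector space generated by the states of `A`, a state being regarded as a function
on effects. -/
abbrev StateSpace (G : ProbTheory C) (A : C) : Submodule ℝ ((A ⟶ 𝟙_ C) → ℝ) :=
  Submodule.span ℝ (Set.range fun (s : 𝟙_ C ⟶ A) (e : A ⟶ 𝟙_ C) => G.prob (s ≫ e))

/-- The vector `|s)` of a state. -/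
def vec (G : ProbTheory C) {A : C} (s : 𝟙_ C ⟶ A) : G.StateSpace A :=
  ⟨fun e => G.prob (s ≫ e), Submodule.subset_span ⟨s, rfl⟩⟩

theorem funLeft_mem (G : ProbTheory C) {A B : C} (g : A ⟶ B) :
    ∀ w ∈ G.StateSpace A,
      LinearMap.funLeft ℝ ℝ (fun e : B ⟶ 𝟙_ C => g ≫ e) w ∈ G.StateSpace B := by
  intro w hw
  induction hw using Submodule.span_induction with
  | mem x hx =>
    obtain ⟨s, rfl⟩ := hx
    refine Submodule.subset_span ⟨s ≫ g, ?_⟩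
    funext e
    simp [LinearMap.funLeft]
  | zero => simp
  | add x y _ _ hx hy => rw [map_add]; exact Submodule.add_mem _ hx hy
  | smul a x _ hx => rw [map_smul]; exact Submodule.smul_mem _ a hx

/-- The linear action of a transformation on the spaces generated by the states. -/
def act (G : ProbTheory C) {A B : C} (g : A ⟶ B) : G.StateSpace A →ₗ[ℝ] G.StateSpace B :=
  (LinearMap.funLeft ℝ ℝ (fun e : B ⟶ 𝟙_ C => g ≫ e)).restrict (G.funLeft_mem g)

theorem act_vec (G : ProbTheory C) {A B : C} (g : A ⟶ B) (s : 𝟙_ C ⟶ A) :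
    G.act g (G.vec s) = G.vec (s ≫ g) := by
  apply Subtype.ext
  funext e
  simp [act, vec, LinearMap.funLeft]

/-- The physical projectors of an experiment with `N` slits on the system `Q`: `P I` leaves open
exactly the slits in `I`. -/
structure Slits (C : Type u) [Category.{v} C] (N : ℕ) (Q : C) where
  P : Finset (Fin N) → (Q ⟶ Q)
  P_comp : ∀ I J, P I ≫ P J = P (I ∩ J)

/-- The coherence-projector `ω_I = ∑_{J ⊆ I} (-1)^{|I|+|J|} P_J`, acting on the vector space
generated by the states of `Q` together with an arbitrary further system `E`. -/
noncomputable def coherenceProj (G : ProbTheory C) {N : ℕ} {Q : C} (S : Slits C N Q)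
    (I : Finset (Fin N)) (E : C) : G.StateSpace (Q ⊗ E) →ₗ[ℝ] G.StateSpace (Q ⊗ E) :=
  ∑ J ∈ I.powerset, ((-1 : ℝ) ^ (I.card + J.card)) • G.act (S.P J ▷ E)

/-- All states (equivalently, all vectors generated by them) decompose as in a rank-`k` tensor,
`|s) = ∑_{1 ≤ |I| ≤ k} ω_I |s)`: the maximal order of interference is `k`. -/
def RankDecomposition (G : ProbTheory C) {N : ℕ} {Q : C} (S : Slits C N Q) (k : ℕ) : Prop :=
  ∀ (E : C) (w : G.StateSpace (Q ⊗ E)),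
    w = ∑ I : Finset (Fin N) with 1 ≤ I.card ∧ I.card ≤ k, G.coherenceProj S I E w

/-- An oracle for functions `f : {1,…,N} → {0,1}` with control system `Q` and target system `T`:
for every `f` a deterministic controlled transformation, which applies `U (f i)` to the
target if only slit `i` is open.  It may be queried in superposition; on the part of the state
that passes through the slits in `I` it gives access only to the values of `f` on `I`. -/
structure Oracle (G : ProbTheory C) {N : ℕ} {Q : C} (S : Slits C N Q) (T : C) where
  U : Bool → (T ⟶ T)
  O : (Fin N → Bool) → (Q ⊗ T ⟶ Q ⊗ T)
  deterministic : ∀ f, G.IsTest (fun _ : Unit => O f)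
  controlled : ∀ f i, S.P {i} ▷ T ≫ O f = S.P {i} ⊗ₘ U (f i)
  coherent : ∀ f g I, (∀ i ∈ I, f i = g i) → S.P I ▷ T ≫ O f = S.P I ▷ T ≫ O g

/-- `𝒪.IsCircuit n c`: the family `c` is given by a circuit built, sequentially and in parallel,
from devices of the theory and exactly `n` uses of the oracle.  `c f z` is the outcome `z` of the
circuit when the oracle is the one of the function `f`. -/
inductive Oracle.IsCircuit {G : ProbTheory C} {N : ℕ} {Q : C} {S : Slits C N Q} {T : C}
    (𝒪 : Oracle G S T) : ∀ (_n : ℕ) {A B : C} {X : Type} [Fintype X],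
      ((Fin N → Bool) → X → (A ⟶ B)) → Prop
  | gate {A B : C} {X : Type} [Fintype X] (t : X → (A ⟶ B)) (ht : G.IsTest t) :
      𝒪.IsCircuit 0 (fun _ => t)
  | query : 𝒪.IsCircuit 1 (fun f (_ : Unit) => 𝒪.O f)
  | comp {m n : ℕ} {A B D : C} {X Y : Type} [Fintype X] [Fintype Y]
      (c : (Fin N → Bool) → X → (A ⟶ B)) (d : (Fin N → Bool) → Y → (B ⟶ D))
      (hc : 𝒪.IsCircuit m c) (hd : 𝒪.IsCircuit n d) :
      𝒪.IsCircuit (m + n) (fun f (z : X × Y) => c f z.1 ≫ d f z.2)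
  | tensor {m n : ℕ} {A B A' B' : C} {X Y : Type} [Fintype X] [Fintype Y]
      (c : (Fin N → Bool) → X → (A ⟶ B)) (d : (Fin N → Bool) → Y → (A' ⟶ B'))
      (hc : 𝒪.IsCircuit m c) (hd : 𝒪.IsCircuit n d) :
      𝒪.IsCircuit (m + n) (fun f (z : X × Y) => c f z.1 ⊗ₘ d f z.2)

/-- The probability that the classical post-processing `a` of the outcome of the closed circuit
`t` gives the answer `y`. -/
def answerProb (G : ProbTheory C) {X Y : Type} [Fintype X] [DecidableEq Y]
    (t : X → (𝟙_ C ⟶ 𝟙_ C)) (a : X → Y) (y : Y) : ℝ :=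
  ∑ z with a z = y, G.prob (t z)

end ProbTheory

/-- `f(1) ⊕ ⋯ ⊕ f(N)`. -/
def parity {N : ℕ} (f : Fin N → Bool) : Bool := (∑ i, (f i).toNat).bodd

/-- The database in which exactly the item `x` is marked. -/
def marked {N : ℕ} (x : Fin N) : Fin N → Bool := fun i => decide (i = x)

/-! This is the polynomial method. The rank-`k` decomposition writes any state as a combination of
`P_J|s)` with `|J| ≤ k`, and on `P_J|s)` the oracle sees only `f` on `J`. So one query adds at most
`k` to the degree in `f`, and the probabilities of an `n`-query circuit have degree at most `n * k`
(`Oracle.IsCircuit.mem_juntaSpan`).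

Parity is orthogonal to every function of degree below `N`, yet correlates positively with a
successful algorithm. For search, the probability `q f` of naming a marked item has degree at most
`n * k + 1`, vanishes on the empty database and is at least `p` on each singleton. Its mean over
independent bits of parameter `t` is a polynomial in `t` with values in `[0, 1]` on the whole unit
interval and slope at least `N * p` at `0`; Markov's inequality bounds that slope by the squared
degree. -/

/-- The span of the functions on the cube that depend on at most `d` coordinates. -/
def juntaSpan (N d : ℕ) : Submodule ℝ ((Fin N → Bool) → ℝ) :=
  Submodule.span ℝ {g | ∃ I : Finset (Fin N), I.card ≤ d ∧ DependsOn g (I : Set (Fin N))}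

namespace juntaSpan

variable {N : ℕ}

theorem of_dependsOn {d : ℕ} {g : (Fin N → Bool) → ℝ} (I : Finset (Fin N)) (hI : I.card ≤ d)
    (hg : DependsOn g (I : Set (Fin N))) : g ∈ juntaSpan N d :=
  Submodule.subset_span ⟨I, hI, hg⟩

theorem const_mem (d : ℕ) (r : ℝ) : (fun _ => r) ∈ juntaSpan N d :=
  of_dependsOn ∅ (by simp) fun _ _ _ => rfl

theorem mul_mem {m n : ℕ} {g h : (Fin N → Bool) → ℝ} (hg : g ∈ juntaSpan N m)
    (hh : h ∈ juntaSpan N n) : g * h ∈ juntaSpan N (m + n) := by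
  induction hg using Submodule.span_induction with
  | mem g hg =>
    obtain ⟨I, hI, hgI⟩ := hg
    induction hh using Submodule.span_induction with
    | mem h hh =>
      obtain ⟨J, hJ, hhJ⟩ := hh
      refine of_dependsOn (I ∪ J) ((Finset.card_union_le I J).trans (by omega)) ?_
      intro x y hxy
      simp only [Pi.mul_apply]
      rw [hgI fun i hi => hxy i (by simp at hi ⊢; exact Or.inl hi),
        hhJ fun i hi => hxy i (by simp at hi ⊢; exact Or.inr hi)]
    | zero => simp
    | add a b _ _ ha hb => rw [mul_add]; exact Submodule.add_mem _ ha hb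
    | smul r a _ ha => rw [mul_smul_comm]; exact Submodule.smul_mem _ r ha
  | zero => simp
  | add a b _ _ ha hb => rw [add_mul]; exact Submodule.add_mem _ ha hb
  | smul r a _ ha => rw [smul_mul_assoc]; exact Submodule.smul_mem _ r ha

/-- The diagonal of a function of two arguments lying separately in two junta spans. -/
theorem diag_mem {m n : ℕ} (F : (Fin N → Bool) → (Fin N → Bool) → ℝ)
    (h₁ : ∀ g, (fun f => F f g) ∈ juntaSpan N m) (h₂ : ∀ f, F f ∈ juntaSpan N n) :
    (fun f => F f f) ∈ juntaSpan N (m + n) := by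
  classical
  -- A linear projection `pr` fixes each `F · g`. Expanding `F · g` in point masses before applying
  -- it separates the two arguments into a finite sum of products.
  obtain ⟨π, hπ⟩ := (juntaSpan N m).subtype.exists_leftInverse_of_injective
    (LinearMap.ker_eq_bot.mpr (juntaSpan N m).injective_subtype)
  let pr := (juntaSpan N m).subtype ∘ₗ π
  have hpr : ∀ w ∈ juntaSpan N m, pr w = w := fun w hw =>
    congrArg Subtype.val (LinearMap.congr_fun hπ ⟨w, hw⟩)
  have key : (fun f => F f f) = ∑ f', pr (Pi.single f' 1) * F f' := by
    funext f
    have h := congrFun (hpr _ (h₁ f)) f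
    have e : (fun f' => F f' f) = ∑ f', F f' f • (Pi.single f' 1 : (Fin N → Bool) → ℝ) := by
      funext x
      simp [Finset.sum_apply, Pi.single_apply]
    rw [← h, e, map_sum]
    simp [Finset.sum_apply, mul_comm]
  rw [key]
  refine Submodule.sum_mem _ fun f' _ => mul_mem ?_ (h₂ f')
  exact Subtype.prop _

end juntaSpan

/-! ### Degree of circuit probabilities in the oracle -/

namespace ProbTheory

variable {C : Type u} [Category.{v} C] [MonoidalCategory C] [SymmetricCategory C]

/-- Moves the second factor of a parallel composition into first position, so that the other wire
joins the environment. -/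
theorem whiskerLeft_whiskerRight_eq_braiding {A A' : C} (B E : C) (g : A ⟶ A') :
    (B ◁ g) ▷ E = (β_ B A).hom ▷ E ≫ (α_ A B E).hom ≫ g ▷ (B ⊗ E) ≫ (α_ A' B E).inv ≫
      (β_ B A').inv ▷ E := by
  rw [associator_inv_naturality_left_assoc, Iso.hom_inv_id_assoc, ← comp_whiskerRight,
    ← comp_whiskerRight, ← BraidedCategory.braiding_naturality_right_assoc]
  simp

theorem coherenceProj_vec_apply (G : ProbTheory C) {N : ℕ} {Q : C} (S : Slits C N Q)
    (I : Finset (Fin N)) (E : C) (s : 𝟙_ C ⟶ Q ⊗ E) (e : Q ⊗ E ⟶ 𝟙_ C) :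
    (G.coherenceProj S I E (G.vec s)).1 e =
      ∑ J ∈ I.powerset, (-1 : ℝ) ^ (I.card + J.card) * G.prob (s ≫ S.P J ▷ E ≫ e) := by
  simp only [coherenceProj, LinearMap.sum_apply, LinearMap.smul_apply, act_vec,
    AddSubmonoidClass.coe_finsetSum, Finset.sum_apply, Submodule.coe_smul, Pi.smul_apply,
    smul_eq_mul]
  simp only [vec, Category.assoc]

theorem RankDecomposition.prob_eq {G : ProbTheory C} {N : ℕ} {Q : C} {S : Slits C N Q} {k : ℕ}
    (hS : G.RankDecomposition S k) {E : C} (s : 𝟙_ C ⟶ Q ⊗ E) (e : Q ⊗ E ⟶ 𝟙_ C) :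
    G.prob (s ≫ e) = ∑ I : Finset (Fin N) with 1 ≤ I.card ∧ I.card ≤ k, ∑ J ∈ I.powerset,
      (-1 : ℝ) ^ (I.card + J.card) * G.prob (s ≫ S.P J ▷ E ≫ e) := by
  have h := congrFun (congrArg Subtype.val (hS E (G.vec s))) e
  simp only [AddSubmonoidClass.coe_finsetSum, Finset.sum_apply, coherenceProj_vec_apply] at h
  exact h

variable {G : ProbTheory C} {N : ℕ} {Q : C} {S : Slits C N Q} {T : C} {𝒪 : Oracle G S T}

theorem Oracle.query_mem_juntaSpan (𝒪 : Oracle G S T) {k : ℕ} (hS : G.RankDecomposition S k)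
    {E : C} (s : 𝟙_ C ⟶ (Q ⊗ T) ⊗ E) (e : (Q ⊗ T) ⊗ E ⟶ 𝟙_ C) :
    (fun f => G.prob (s ≫ 𝒪.O f ▷ E ≫ e)) ∈ juntaSpan N k := by
  have key : (fun f => G.prob (s ≫ 𝒪.O f ▷ E ≫ e)) =
      ∑ I : Finset (Fin N) with 1 ≤ I.card ∧ I.card ≤ k, ∑ J ∈ I.powerset,
        (-1 : ℝ) ^ (I.card + J.card) •
          fun f => G.prob (s ≫ (S.P J ▷ T ≫ 𝒪.O f) ▷ E ≫ e) := by
    funext f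
    have h := hS.prob_eq (s ≫ (α_ Q T E).hom) ((α_ Q T E).inv ≫ 𝒪.O f ▷ E ≫ e)
    simp only [Category.assoc, Iso.hom_inv_id_assoc] at h
    rw [h]
    simp only [Finset.sum_apply, Pi.smul_apply, smul_eq_mul]
    refine Finset.sum_congr rfl fun I _ => Finset.sum_congr rfl fun J _ => ?_
    congr 2
    simp
  rw [key]
  refine Submodule.sum_mem _ fun I hI => Submodule.sum_mem _ fun J hJ =>
    Submodule.smul_mem _ _ (juntaSpan.of_dependsOn J ?_ ?_)
  · exact (Finset.card_le_card (Finset.mem_powerset.mp hJ)).trans (Finset.mem_filter.mp hI).2.2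
  · intro f g hfg
    simp only
    rw [𝒪.coherent f g J fun i hi => hfg i (by simpa using hi)]

/-- The outcome probabilities of a circuit with `n` queries, put into any experiment, are
combinations of functions of at most `n * k` values of the oracle. -/
theorem Oracle.IsCircuit.mem_juntaSpan {k : ℕ} (hS : G.RankDecomposition S k) {n : ℕ} {A B : C}
    {X : Type} [Fintype X] {c : (Fin N → Bool) → X → (A ⟶ B)} (hc : 𝒪.IsCircuit n c) (z : X)
    {E : C} (s : 𝟙_ C ⟶ A ⊗ E) (e : B ⊗ E ⟶ 𝟙_ C) :
    (fun f => G.prob (s ≫ c f z ▷ E ≫ e)) ∈ juntaSpan N (n * k) := by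
  -- The claim covers all environments, so the frozen half of a composite can be absorbed into the
  -- state or the effect.
  induction hc generalizing E with
  | gate t ht => exact juntaSpan.const_mem _ _
  | query => simpa using 𝒪.query_mem_juntaSpan hS s e
  | comp c d hc hd ihc ihd =>
    rw [add_mul]
    have := juntaSpan.diag_mem
      (fun f g => G.prob (s ≫ (c f z.1 ≫ d g z.2) ▷ E ≫ e))
      (fun g => by simpa using ihc z.1 s (d g z.2 ▷ E ≫ e))
      (fun f => by simpa using ihd z.2 (s ≫ c f z.1 ▷ E) e)
    exact this
  | @tensor m n A B A' B' X Y _ _ c d hc hd ihc ihd =>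
    rw [add_mul]
    have := juntaSpan.diag_mem
      (fun f g => G.prob (s ≫ (c f z.1 ⊗ₘ d g z.2) ▷ E ≫ e))
      (fun g => by
        convert ihc z.1 (s ≫ (α_ A A' E).hom) (B ◁ (d g z.2 ▷ E) ≫ (α_ B B' E).inv ≫ e) using 3
        simp [MonoidalCategory.tensorHom_def])
      (fun f => by
        convert ihd z.2 (s ≫ (c f z.1 ▷ A') ▷ E ≫ (β_ B A').hom ▷ E ≫ (α_ A' B E).hom)
          ((α_ B' B E).inv ≫ (β_ B B').inv ▷ E ≫ e) using 3
        rw [MonoidalCategory.tensorHom_def, comp_whiskerRight, whiskerLeft_whiskerRight_eq_braiding]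
        simp only [Category.assoc])
    exact this

theorem Oracle.IsCircuit.isTest {n : ℕ} {A B : C} {X : Type} [Fintype X]
    {c : (Fin N → Bool) → X → (A ⟶ B)} (hc : 𝒪.IsCircuit n c) (f : Fin N → Bool) :
    G.IsTest (c f) := by
  induction hc with
  | gate t ht => exact ht
  | query => exact 𝒪.deterministic f
  | comp c d hc hd ihc ihd => exact G.test_comp _ _ ihc ihd
  | tensor c d hc hd ihc ihd => exact G.test_tensor _ _ ihc ihd

theorem Oracle.IsCircuit.prob_mem_juntaSpan {k : ℕ} (hS : G.RankDecomposition S k) {n : ℕ}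
    {X : Type} [Fintype X] {c : (Fin N → Bool) → X → (𝟙_ C ⟶ 𝟙_ C)} (hc : 𝒪.IsCircuit n c)
    (z : X) : (fun f => G.prob (c f z)) ∈ juntaSpan N (n * k) := by
  simpa using hc.mem_juntaSpan hS z (ρ_ (𝟙_ C)).inv (ρ_ (𝟙_ C)).hom

theorem Oracle.IsCircuit.answerProb_mem_juntaSpan {k : ℕ} (hS : G.RankDecomposition S k) {n : ℕ}
    {X Y : Type} [Fintype X] [DecidableEq Y] {c : (Fin N → Bool) → X → (𝟙_ C ⟶ 𝟙_ C)}
    (hc : 𝒪.IsCircuit n c) (a : X → Y) (y : Y) :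
    (fun f => G.answerProb (c f) a y) ∈ juntaSpan N (n * k) := by
  have : (fun f => G.answerProb (c f) a y) = ∑ z with a z = y, fun f => G.prob (c f z) := by
    funext f
    simp [answerProb]
  rw [this]
  exact Submodule.sum_mem _ fun z _ => hc.prob_mem_juntaSpan hS z

theorem answerProb_nonneg (G : ProbTheory C) {X Y : Type} [Fintype X] [DecidableEq Y]
    (t : X → (𝟙_ C ⟶ 𝟙_ C)) (a : X → Y) (y : Y) : 0 ≤ G.answerProb t a y :=
  Finset.sum_nonneg fun _ _ => G.prob_nonneg _

theorem sum_answerProb (G : ProbTheory C) {X Y : Type} [Fintype X] [Fintype Y] [DecidableEq Y]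
    {t : X → (𝟙_ C ⟶ 𝟙_ C)} (ht : G.IsTest t) (a : X → Y) : ∑ y, G.answerProb t a y = 1 := by
  simp only [answerProb]
  rw [Finset.sum_fiberwise, G.sum_prob t ht]

end ProbTheory

/-! ### Slope at zero of bounded polynomials and Bernoulli averaging -/

open Polynomial in
/-- The endpoint case of Markov's inequality for polynomials, on the unit interval. -/
theorem derivative_eval_zero_le_sq {d : ℕ} {R : ℝ[X]} (hd : R.natDegree ≤ d)
    (h : ∀ t ∈ Set.Icc (0 : ℝ) 1, R.eval t ∈ Set.Icc (0 : ℝ) 1) :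
    R.derivative.eval 0 ≤ (d : ℝ) ^ 2 := by
  -- The affine map `l` takes `[-1, 1]` to `[0, 1]` and `1` to `0`; the factors `-2` and `-1/2`
  -- cancel, so `W'(1) = R'(0)`.
  set l : ℝ[X] := C (1 / 2) - C (1 / 2) * X with hl
  set W : ℝ[X] := C 1 - C 2 * R.comp l with hW
  have hlt : ∀ x, l.eval x = (1 - x) / 2 := fun x => by simp [hl]; ring
  have hldeg : l.natDegree ≤ 1 := by
    rw [hl]; compute_degree
  have hWdeg : W.natDegree ≤ d := by
    refine (natDegree_sub_le _ _).trans (max_le (by simp) ?_)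
    refine (natDegree_C_mul_le _ _).trans (natDegree_comp_le.trans ?_)
    calc R.natDegree * l.natDegree ≤ d * 1 := Nat.mul_le_mul hd hldeg
      _ = d := mul_one d
  have hb : ∀ x ∈ Set.Icc (-1 : ℝ) 1, |W.eval x| ≤ 1 := by
    intro x hx
    have := h ((1 - x) / 2) ⟨by linarith [hx.2], by linarith [hx.1]⟩
    rw [abs_le]
    simp only [hW, eval_sub, eval_C, eval_mul, eval_comp, hlt]
    constructor <;> linarith [this.1, this.2]
  have key := Polynomial.Chebyshev.eval_iterate_derivative_le_of_forall_abs_le_one (k := 1)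
    (le_refl (1 : ℝ)) (natDegree_le_iff_degree_le.mp hWdeg) hb
  have e1 : (derivative^[1] W).eval 1 = R.derivative.eval 0 := by
    simp [hW, hl, derivative_comp]
  have e2 : (derivative^[1] (Polynomial.Chebyshev.T ℝ d)).eval 1 = (d : ℝ) ^ 2 := by
    rw [Function.iterate_one, Polynomial.Chebyshev.T_derivative_eq_U]
    simp [sq]
  rwa [e1, e2] at key

open Polynomial in
/-- A polynomial vanishing at `0` and dominating `r t (1 - t) ^ m` on the unit interval has slope at
least `r` at `0`. -/
theorem le_derivative_eval_zero {R : ℝ[X]} {r : ℝ} {m : ℕ} (h0 : R.eval 0 = 0)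
    (h : ∀ t ∈ Set.Icc (0 : ℝ) 1, r * (t * (1 - t) ^ m) ≤ R.eval t) :
    r ≤ R.derivative.eval 0 := by
  -- Divide the inequality by `t` and let `t` tend to `0` from the right.
  obtain ⟨W, hW⟩ : X ∣ R := by rwa [X_dvd_iff, coeff_zero_eq_eval_zero]
  have e : R.derivative.eval 0 = W.eval 0 := by simp [hW]
  rw [e]
  have hc : Filter.Tendsto (fun t : ℝ => W.eval t - r * (1 - t) ^ m) (nhdsWithin 0 (Set.Ioi 0))
      (nhds (W.eval 0 - r * (1 - 0) ^ m)) := by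
    have : Continuous fun t : ℝ => W.eval t - r * (1 - t) ^ m := by fun_prop
    exact this.continuousAt.tendsto.mono_left nhdsWithin_le_nhds
  have hn : 0 ≤ W.eval 0 - r * (1 - 0) ^ m := by
    refine ge_of_tendsto hc ?_
    filter_upwards [Ioo_mem_nhdsGT (zero_lt_one (α := ℝ))] with t ht
    have h' := h t ⟨ht.1.le, ht.2.le⟩
    rw [hW, eval_mul, eval_X] at h'
    have : t * (r * (1 - t) ^ m) ≤ t * W.eval t := by linarith
    linarith [le_of_mul_le_mul_left this ht.1]
  simpa using hn

open Polynomial in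
/-- The probability of a bit under the Bernoulli distribution of parameter `X`. -/
noncomputable def bernoulliWeight (b : Bool) : ℝ[X] := if b then X else 1 - X

open Polynomial in
/-- The mean of `q` over independent bits of parameter `X`. -/
noncomputable def bernoulliMean {N : ℕ} : ((Fin N → Bool) → ℝ) →ₗ[ℝ] ℝ[X] where
  toFun q := ∑ f, q f • ∏ i, bernoulliWeight (f i)
  map_add' q q' := by simp [add_smul, Finset.sum_add_distrib]
  map_smul' r q := by simp [mul_smul, Finset.smul_sum]

section

variable {N : ℕ}

theorem bernoulliMean_apply (q : (Fin N → Bool) → ℝ) :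
    bernoulliMean q = ∑ f, q f • ∏ i, bernoulliWeight (f i) := rfl

theorem eval_bernoulliMean (q : (Fin N → Bool) → ℝ) (t : ℝ) :
    (bernoulliMean q).eval t = ∑ f, q f * ∏ i, if f i then t else 1 - t := by
  rw [bernoulliMean_apply, Polynomial.eval_finsetSum]
  refine Finset.sum_congr rfl fun f _ => ?_
  rw [Polynomial.eval_smul, Polynomial.eval_prod, smul_eq_mul]
  congr 1
  refine Finset.prod_congr rfl fun i _ => ?_
  unfold bernoulliWeight
  split <;> simp

theorem bernoulliMean_prod (h : Fin N → Bool → ℝ) :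
    bernoulliMean (fun f => ∏ i, h i (f i)) = ∏ i, ∑ b, h i b • bernoulliWeight b := by
  rw [bernoulliMean_apply, Finset.prod_univ_sum, Fintype.piFinset_univ]
  refine Finset.sum_congr rfl fun f _ => ?_
  simp only [Polynomial.smul_eq_C_mul, Finset.prod_mul_distrib, map_prod]

theorem sum_bernoulliWeight : ∑ b, bernoulliWeight b = 1 := by
  simp [bernoulliWeight]

theorem natDegree_bernoulliWeight_le (b : Bool) : (bernoulliWeight b).natDegree ≤ 1 := by
  unfold bernoulliWeight
  split
  · exact Polynomial.natDegree_X_le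
  · compute_degree

/-- Product form lets the Bernoulli mean factor over coordinates. Assignments are pinned to `false`
off `I` so that each pattern on `I` occurs once. -/
theorem DependsOn.eq_sum_prod {q : (Fin N → Bool) → ℝ} {I : Finset (Fin N)}
    (hq : DependsOn q (I : Set (Fin N))) :
    q = ∑ a ∈ Fintype.piFinset (fun i => if i ∈ I then Finset.univ else {false}),
      q a • fun f => ∏ i, if i ∈ I → f i = a i then (1 : ℝ) else 0 := by
  funext f
  simp only [Finset.sum_apply, Pi.smul_apply, smul_eq_mul]
  rw [Finset.sum_eq_single (fun i => if i ∈ I then f i else false)]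
  · rw [Finset.prod_eq_one]
    · rw [mul_one]
      exact hq fun i hi => by simp [Finset.mem_coe.mp hi]
    · intro i _
      rw [if_pos]
      intro hi
      simp [hi]
  · intro a ha hne
    obtain ⟨i, hi⟩ := Function.ne_iff.mp hne
    have hai := Fintype.mem_piFinset.mp ha i
    by_cases hI : i ∈ I
    · rw [Finset.prod_eq_zero (Finset.mem_univ i), mul_zero]
      simp only [hI, if_true] at hi
      simp [hI, Ne.symm hi]
    · simp only [hI, if_false, Finset.mem_singleton] at hi hai
      exact absurd hai hi
  · intro hn
    refine absurd (Fintype.mem_piFinset.mpr fun i => ?_) hn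
    split <;> simp

/-- Coordinates outside `I` average to `1`, leaving at most `|I|` factors of degree at most one. -/
theorem natDegree_bernoulliMean_le {d : ℕ} {q : (Fin N → Bool) → ℝ} (hq : q ∈ juntaSpan N d) :
    (bernoulliMean q).natDegree ≤ d := by
  induction hq using Submodule.span_induction with
  | mem q hq =>
    obtain ⟨I, hI, hqI⟩ := hq
    rw [hqI.eq_sum_prod, map_sum]
    refine Polynomial.natDegree_sum_le_of_forall_le _ _ fun a _ => ?_
    rw [map_smul, bernoulliMean_prod (fun i b => if i ∈ I → b = a i then (1 : ℝ) else 0)]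
    refine (Polynomial.natDegree_smul_le _ _).trans ((Polynomial.natDegree_prod_le _ _).trans ?_)
    calc _ ≤ ∑ i, if i ∈ I then 1 else 0 := Finset.sum_le_sum fun i _ => by
          split
          · exact Polynomial.natDegree_sum_le_of_forall_le _ _ fun b _ =>
              (Polynomial.natDegree_smul_le _ _).trans (natDegree_bernoulliWeight_le b)
          · next hi => simp only [hi, false_imp_iff, if_true, one_smul, sum_bernoulliWeight,
              Polynomial.natDegree_one, le_refl]
      _ = I.card := by simp
      _ ≤ d := hI
  | zero => simp
  | add a b _ _ ha hb =>
    rw [map_add]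
    exact (Polynomial.natDegree_add_le _ _).trans (max_le ha hb)
  | smul r a _ ha =>
    rw [map_smul]
    exact (Polynomial.natDegree_smul_le _ _).trans ha

theorem eval_bernoulliMean_mem_Icc {q : (Fin N → Bool) → ℝ} (h : ∀ f, q f ∈ Set.Icc (0 : ℝ) 1)
    {t : ℝ} (ht : t ∈ Set.Icc (0 : ℝ) 1) : (bernoulliMean q).eval t ∈ Set.Icc (0 : ℝ) 1 := by
  have hw : ∀ f : Fin N → Bool, 0 ≤ ∏ i, (if f i then t else 1 - t) := fun f =>
    Finset.prod_nonneg fun i _ => by split <;> linarith [ht.1, ht.2]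
  have h1 : ∑ f : Fin N → Bool, ∏ i, (if f i then t else 1 - t) = 1 := by
    have := Finset.prod_univ_sum (fun _ : Fin N => (Finset.univ : Finset Bool))
      (fun _ b => if b then t else 1 - t)
    rw [Fintype.piFinset_univ] at this
    rw [← this]
    simp
  rw [eval_bernoulliMean]
  refine ⟨Finset.sum_nonneg fun f _ => mul_nonneg (h f).1 (hw f), ?_⟩
  refine le_of_le_of_eq ?_ h1
  exact Finset.sum_le_sum fun f _ => mul_le_of_le_one_left (hw f) (h f).2

theorem eval_zero_bernoulliMean (q : (Fin N → Bool) → ℝ) :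
    (bernoulliMean q).eval 0 = q fun _ => false := by
  rw [eval_bernoulliMean, Finset.sum_eq_single fun _ => false]
  · simp
  · intro f _ hf
    obtain ⟨i, hi⟩ := Function.ne_iff.mp hf
    rw [Finset.prod_eq_zero (Finset.mem_univ i), mul_zero]
    simpa using hi
  · simp

theorem marked_injective : Function.Injective (marked (N := N)) := by
  intro x y h
  simpa [marked] using congrFun h x

theorem prod_marked (x : Fin N) (t : ℝ) :
    (∏ i, if marked x i then t else 1 - t) = t * (1 - t) ^ (N - 1) := by
  rw [← Finset.mul_prod_erase _ _ (Finset.mem_univ x)]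
  congr 1
  · simp [marked]
  · rw [Finset.prod_congr rfl (g := fun _ => 1 - t)]
    · simp
    · intro i hi
      simp [marked, Finset.ne_of_mem_erase hi]

theorem le_eval_bernoulliMean {q : (Fin N → Bool) → ℝ} {p : ℝ} (h : ∀ f, 0 ≤ q f)
    (hp : ∀ x, p ≤ q (marked x)) {t : ℝ} (ht : t ∈ Set.Icc (0 : ℝ) 1) :
    N * p * (t * (1 - t) ^ (N - 1)) ≤ (bernoulliMean q).eval t := by
  have h0 : 0 ≤ t * (1 - t) ^ (N - 1) :=
    mul_nonneg ht.1 (pow_nonneg (by linarith [ht.2]) _)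
  rw [eval_bernoulliMean]
  calc N * p * (t * (1 - t) ^ (N - 1))
      = ∑ _x : Fin N, p * (t * (1 - t) ^ (N - 1)) := by simp [mul_assoc]
    _ ≤ ∑ x : Fin N, q (marked x) * ∏ i, if marked x i then t else 1 - t :=
        Finset.sum_le_sum fun x _ => by
          rw [prod_marked]; exact mul_le_mul_of_nonneg_right (hp x) h0
    _ = ∑ f ∈ Finset.univ.map ⟨marked, marked_injective⟩,
          q f * ∏ i, if f i then t else 1 - t := by simp
    _ ≤ _ := Finset.sum_le_sum_of_subset_of_nonneg (Finset.subset_univ _) fun f _ _ =>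
        mul_nonneg (h f) (Finset.prod_nonneg fun i _ => by split <;> linarith [ht.1, ht.2])

/-- A function on the cube with values in the unit interval which separates the empty database from
those with one marked item has degree at least of the order `√N`. -/
theorem card_mul_le_sq_of_mem_juntaSpan {d : ℕ} {q : (Fin N → Bool) → ℝ} {p : ℝ}
    (hq : q ∈ juntaSpan N d) (h : ∀ f, q f ∈ Set.Icc (0 : ℝ) 1) (h0 : (q fun _ => false) = 0)
    (hp : ∀ x, p ≤ q (marked x)) : N * p ≤ (d : ℝ) ^ 2 :=
  (le_derivative_eval_zero ((eval_zero_bernoulliMean q).trans h0) fun _ ht =>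
      le_eval_bernoulliMean (fun f => (h f).1) hp ht).trans
    (derivative_eval_zero_le_sq (natDegree_bernoulliMean_le hq) fun _ ht =>
      eval_bernoulliMean_mem_Icc h ht)

/-! ### Orthogonality of parity to low degree -/

/-- The character `(-1) ^ (f(1) + ⋯ + f(N))`. -/
def paritySign (f : Fin N → Bool) : ℝ := ∏ i, if f i then -1 else 1

theorem paritySign_eq (f : Fin N → Bool) : paritySign f = if parity f then -1 else 1 := by
  have e : paritySign f = (-1 : ℝ) ^ ∑ i, (f i).toNat := by
    rw [paritySign, ← Finset.prod_pow_eq_pow_sum]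
    refine Finset.prod_congr rfl fun i _ => ?_
    cases f i <;> simp
  rw [e, parity]
  generalize ∑ i, (f i).toNat = m
  induction m with
  | zero => simp
  | succ m ih => rw [pow_succ, ih, Nat.bodd_succ]; cases m.bodd <;> simp

/-- Parity is orthogonal to all functions of degree less than `N`. -/
theorem sum_paritySign_mul_eq_zero {d : ℕ} (hd : d < N) {q : (Fin N → Bool) → ℝ}
    (hq : q ∈ juntaSpan N d) : ∑ f, paritySign f * q f = 0 := by
  induction hq using Submodule.span_induction with
  | mem q hq =>
    obtain ⟨I, hI, hqI⟩ := hq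
    obtain ⟨j, hj⟩ : ∃ j, j ∉ I := by
      by_contra! hall
      have : I = Finset.univ := Finset.eq_univ_of_forall hall
      simp [this] at hI
      omega
    -- Flipping a coordinate `j` outside `I` preserves `q` and negates the sign, so terms cancel in
    -- pairs.
    refine Finset.sum_involution (fun f _ => Function.update f j (!f j)) ?_ ?_ (by simp) ?_
    · intro f _
      have hq' : q (Function.update f j (!f j)) = q f := hqI fun i hi => by
        rw [Function.update_of_ne]
        rintro rfl
        exact hj hi
      have hs : paritySign (Function.update f j (!f j)) = -paritySign f := by
        rw [paritySign, paritySign, ← Finset.mul_prod_erase _ _ (Finset.mem_univ j),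
          ← Finset.mul_prod_erase _ _ (Finset.mem_univ j), ← neg_mul]
        congr 1
        · cases h : f j <;> simp
        · refine Finset.prod_congr rfl fun i hi => ?_
          rw [Function.update_of_ne (Finset.ne_of_mem_erase hi)]
      rw [hq', hs]
      ring
    · intro f _ _ h
      have := congrFun h j
      simp at this
    · intro f _
      simp
  | zero => simp
  | add a b _ _ ha hb => simp [mul_add, Finset.sum_add_distrib, ha, hb]
  | smul r a _ ha =>
    simp only [Pi.smul_apply, smul_eq_mul]
    rw [← mul_zero r, ← ha, Finset.mul_sum]
    exact Finset.sum_congr rfl fun f _ => by ring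

end

/-! ### Query lower bounds -/

namespace ProbTheory

variable {C : Type u} [Category.{v} C] [MonoidalCategory C] [SymmetricCategory C]
  {G : ProbTheory C} {k N : ℕ} {Q T : C} {S : Slits C N Q} {𝒪 : Oracle G S T} {n : ℕ}
  {X : Type} [Fintype X] {c : (Fin N → Bool) → X → (𝟙_ C ⟶ 𝟙_ C)}

/-- At every `f`, `1/2` minus the probability of answering `true` has the sign of the parity
character, so their inner product is positive. -/
theorem Oracle.IsCircuit.le_mul_of_parity (hS : G.RankDecomposition S k) (hc : 𝒪.IsCircuit n c)
    {a : X → Bool} (h : ∀ f, 1 / 2 < G.answerProb (c f) a (parity f)) : N ≤ n * k := by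
  by_contra! hlt
  have hm := Submodule.sub_mem _ (juntaSpan.const_mem (N := N) (n * k) (1 / 2))
    (hc.answerProb_mem_juntaSpan hS a true)
  refine (sum_paritySign_mul_eq_zero hlt hm).not_gt (Finset.sum_pos (fun f _ => ?_)
    ⟨fun _ => false, Finset.mem_univ _⟩)
  have h1 := G.sum_answerProb (hc.isTest f) a
  have h2 := h f
  rw [Fintype.sum_bool] at h1
  rw [paritySign_eq]
  cases hp : parity f <;> rw [hp] at h2 <;> simp only [Pi.sub_apply] <;> norm_num <;> linarith

theorem Oracle.IsCircuit.mul_le_sq_of_search (hS : G.RankDecomposition S k)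
    (hc : 𝒪.IsCircuit n c) {a : X → Fin N} {p : ℝ}
    (h : ∀ x, p ≤ G.answerProb (c (marked x)) a x) : N * p ≤ ((n * k + 1 : ℕ) : ℝ) ^ 2 := by
  -- Multiplying by `f x` checks the answer at the cost of one degree, and forces `q` to vanish on
  -- the empty database, where the algorithm is otherwise unconstrained.
  set q : (Fin N → Bool) → ℝ :=
    ∑ x, (fun f => G.answerProb (c f) a x) * fun f => if f x then 1 else 0 with hq
  have hqf : ∀ f, q f = ∑ x, G.answerProb (c f) a x * if f x then 1 else 0 := fun f => by
    simp [hq]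
  refine card_mul_le_sq_of_mem_juntaSpan (q := q) ?_ ?_ ?_ ?_
  · refine Submodule.sum_mem _ fun x _ =>
      juntaSpan.mul_mem (hc.answerProb_mem_juntaSpan hS a x)
        (juntaSpan.of_dependsOn {x} (by simp) fun f g hfg => ?_)
    simp [hfg x (by simp)]
  · intro f
    rw [hqf]
    constructor
    · exact Finset.sum_nonneg fun x _ =>
        mul_nonneg (G.answerProb_nonneg _ _ _) (by split <;> norm_num)
    · refine le_of_le_of_eq ?_ (G.sum_answerProb (hc.isTest f) a)
      exact Finset.sum_le_sum fun x _ =>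
        mul_le_of_le_one_right (G.answerProb_nonneg _ _ _) (by split <;> norm_num)
  · simp [hqf]
  · intro x
    rw [hqf, Finset.sum_eq_single x]
    · simpa [marked] using h x
    · intro y _ hy
      simp [marked, hy]
    · simp

end ProbTheory

theorem mul_sqrt_div_le_of_mul_le_sq {k N n : ℕ} {p : ℝ} (hk : 1 ≤ k) (hp : 0 < p)
    (hN : 4 / p ≤ N) (h : N * p ≤ ((n * k + 1 : ℕ) : ℝ) ^ 2) :
    √p / (2 * k) * √(N / k) ≤ n := by
  have hk' : (1 : ℝ) ≤ k := by exact_mod_cast hk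
  have h4 : 4 ≤ N * p := (div_le_iff₀ hp).mp hN
  -- Hence the `+ 1` is at most half of `√(N * p)`; this is where `4 / p` and the `2` in the
  -- constant come from.
  have h2 : 2 ≤ √(N * p) := Real.le_sqrt_of_sq_le (by linarith)
  have hs : √(N * p) ≤ n * k + 1 := by
    refine (Real.sqrt_le_sqrt h).trans ?_
    rw [Real.sqrt_sq (by positivity)]
    push_cast
    exact le_rfl
  have hd : √((N : ℝ) / k) ≤ √N := Real.sqrt_le_sqrt (div_le_self (by positivity) hk')
  calc √p / (2 * k) * √(N / k) ≤ √p / (2 * k) * √N := by gcongr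
    _ = √(N * p) / (2 * k) := by rw [Real.sqrt_mul (by positivity)]; ring
    _ ≤ n := by
      rw [div_le_iff₀ (by positivity)]
      linarith

theorem mainTheorem2 :
    (∀ (C : Type u) [Category.{v} C] [MonoidalCategory C] [SymmetricCategory C]
      (G : ProbTheory C) (k N : ℕ) (Q T : C) (S : ProbTheory.Slits C N Q)
      (𝒪 : ProbTheory.Oracle G S T) (n : ℕ) (X : Type) [Fintype X]
      (c : (Fin N → Bool) → X → (𝟙_ C ⟶ 𝟙_ C)) (a : X → Bool),
      1 ≤ k → G.RankDecomposition S k → 𝒪.IsCircuit n c →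
      (∀ f : Fin N → Bool, 1 / 2 < G.answerProb (c f) a (parity f)) →
      ⌈(N : ℝ) / (k : ℝ)⌉₊ ≤ n) ∧
    (∀ (k : ℕ) (p : ℝ), 1 ≤ k → 0 < p →
      ∃ (δ : ℝ) (N₀ : ℕ), 0 < δ ∧ ∀ N : ℕ, N₀ ≤ N →
      ∀ (C : Type u) [Category.{v} C] [MonoidalCategory C] [SymmetricCategory C]
      (G : ProbTheory C) (Q T : C) (S : ProbTheory.Slits C N Q)
      (𝒪 : ProbTheory.Oracle G S T) (n : ℕ) (X : Type) [Fintype X]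
      (c : (Fin N → Bool) → X → (𝟙_ C ⟶ 𝟙_ C)) (a : X → Fin N),
      G.RankDecomposition S k → 𝒪.IsCircuit n c →
      (∀ x : Fin N, p ≤ G.answerProb (c (marked x)) a x) →
      δ * Real.sqrt ((N : ℝ) / (k : ℝ)) ≤ (n : ℝ)) := by

  refine ⟨?_, ?_⟩
  · intro C _ _ _ G k N Q T S 𝒪 n X _ c a hk hS hc h
    have hN : (N : ℝ) ≤ n * k := by exact_mod_cast hc.le_mul_of_parity hS h
    exact Nat.ceil_le.mpr ((div_le_iff₀ (by exact_mod_cast hk)).mpr hN)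
  · intro k p hk hp
    refine ⟨√p / (2 * k), ⌈4 / p⌉₊, div_pos (Real.sqrt_pos.mpr hp) (by positivity), ?_⟩
    intro N hN C _ _ _ G Q T S 𝒪 n X _ c a hS hc h
    exact mul_sqrt_div_le_of_mul_le_sq hk hp (Nat.ceil_le.mp hN) (hc.mul_le_sq_of_search hS h)
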